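/- Consider $\mathbb Z^2$ as a graph with edges between vertices at $\ell^1$-distance $1$, and the dual lattice $(\mathbb Z^2)^*=(\tfrac12,\tfrac12)+\mathbb Z^2$ with the same adjacency; each dual edge $e^*$ crosses a unique edge $e$ of $\mathbb Z^2$. For a finite set $C\subset\mathbb Z^2$ let $\partial C^c$ be the set of vertices outside $C$ having a neighbour in $C$, and $\bar C=C\cup\partial C^c$. Given $w:E(\mathbb Z^2)\to\mathbb R$, $\beta\ge 0$ and $\tau\in\{\pm1\}^{\partial C^c}$, let $\mathbb P^{C,\tau}_{w,\beta}$ be the probability measure on the configurations $\zeta\in\{\pm1\}^{\bar C}$ with $\zeta|_{\partial C^c}=\tau$ that is proportional to $\exp\big(\beta\sum_{\{x,y\}}w_{xy}\zeta_x\zeta_y\big)$, where the sum is over all edges $\{x,y\}$ of $\mathbb Z^2$ with $x,y\in\bar C$. An EA$_\beta$ spin-glass measure is a joint law $\nu$ of interactions $w\in\mathbb R^{E(\mathbb Z^2)}$ and spins $\sigma\in\{\pm1\}^{\mathbb Z^2}$ such that the $w_e$ are i.i.d. standard normal and, for every finite $C\subset\mathbb Z^2$, $$\mathbb P_\nu(\sigma_{\bar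 C}\in\cdot\mid \sigma_{C^c},w)=\mathbb P^{C,\sigma_{\partial C^c}}_{w,\beta}(\cdot)\quad\nu\text{-almost surely.}$$ It is translation invariant if it is invariant under the simultaneous translation of $w$ and $\sigma$ by every vector of $\mathbb Z^2$. An edge $e=\{x,y\}$ and its dual edge $e^*$ are unsatisfied if $w_e\sigma_x\sigma_y<0$. A dual cycle is a nontrivial closed path in $(\mathbb Z^2)^*$ that uses no edge twice (it may revisit vertices; simple cycles are included), and it is unsatisfied if all its edges are. There exists $\beta_0>0$ such that for every real $\beta>\beta_0$ and every translation-invariant EA$_\beta$ spin-glass measure $\nu$, $\nu$-almost surely the following holds: through every dual vertex there pass only finitely many unsatisfied dual cycles. -/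

import Mathlib

open MeasureTheory ProbabilityTheory

noncomputable section

namespace EdwardsAnderson

/-! The square lattice -/

/-- Vertices of the square lattice `ℤ²`. -/
abbrev Vertex : Type := ℤ × ℤ

/-- The graph `ℤ²`: two vertices are joined when their `ℓ¹` distance is `1`. -/
def lattice : SimpleGraph Vertex where
  Adj x y := |x.1 - y.1| + |x.2 - y.2| = 1
  symm := ⟨fun x y h => by rw [abs_sub_comm y.1, abs_sub_comm y.2]; exact h⟩
  loopless := ⟨fun x h => by simp at h⟩

instance : DecidableRel lattice.Adj := fun x y =>
  inferInstanceAs (Decidable (|x.1 - y.1| + |x.2 - y.2| = 1))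

/-- The four lattice neighbours of a vertex. -/
def neighbors (x : Vertex) : Finset Vertex :=
  {(x.1 + 1, x.2), (x.1 - 1, x.2), (x.1, x.2 + 1), (x.1, x.2 - 1)}

theorem mem_neighbors {x y : Vertex} : y ∈ neighbors x ↔ lattice.Adj x y := by
  obtain ⟨a, b⟩ := x
  obtain ⟨c, d⟩ := y
  simp only [neighbors, lattice, Finset.mem_insert, Finset.mem_singleton, Prod.mk.injEq]
  grind

/-- Edges of `ℤ²`. -/
abbrev Edge : Type := lattice.edgeSet

/-- Real-valued interactions on the edges of `ℤ²`. -/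
abbrev Interaction : Type := Edge → ℝ

/-- The two spin values `1` and `-1`. -/
abbrev Spin : Type := ℤˣ

instance : MeasurableSingletonClass Spin where
  measurableSet_singleton s :=
    ⟨{(s : ℤ)}, measurableSet_singleton _, by ext t; simp [Units.ext_iff]⟩

/-- Spin configurations on `ℤ²`. -/
abbrev SpinConfig : Type := Vertex → Spin

/-- The product `σ_x σ_y`, as a real number, of the two spins at the ends of a pair `{x, y}`. -/
def spinProduct {V : Type*} (σ : V → Spin) (e : Sym2 V) : ℝ :=
  (((e.map σ).mul : ℤˣ) : ℤ)

/-! Finite-volume Boltzmann-Gibbs distributions -/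

/-- `∂Cᶜ`: the vertices outside `C` that have a neighbour in `C`. -/
def outerBoundary (C : Finset Vertex) : Finset Vertex := C.biUnion neighbors \ C

theorem mem_outerBoundary {C : Finset Vertex} {y : Vertex} :
    y ∈ outerBoundary C ↔ y ∉ C ∧ ∃ x ∈ C, lattice.Adj y x := by
  simp only [outerBoundary, Finset.mem_sdiff, Finset.mem_biUnion, mem_neighbors,
    lattice.adj_comm y]
  tauto

/-- `C̄ = C ∪ ∂Cᶜ`. -/
def closedRegion (C : Finset Vertex) : Finset Vertex := C ∪ outerBoundary C

/-- A boundary vertex, seen as a vertex of `C̄`. -/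
def boundaryIncl {C : Finset Vertex} (x : outerBoundary C) : closedRegion C :=
  ⟨x.1, Finset.mem_union_right _ x.2⟩

/-- The set of spin configurations on `C̄` that agree with the boundary condition `τ` on `∂Cᶜ`. -/
def configsWithBoundary (C : Finset Vertex) (τ : outerBoundary C → Spin) :
    Finset (closedRegion C → Spin) :=
  Finset.univ.filter fun ζ => ∀ x : outerBoundary C, ζ (boundaryIncl x) = τ x

/-- The Hamiltonian `H(ζ) = -∑ w_{xy} ζ_x ζ_y`, summed over the (unordered) pairs `{x, y}` of
neighbouring vertices of a finite set `D`. -/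
def hamiltonian (w : Interaction) (D : Finset Vertex) (ζ : D → Spin) : ℝ :=
  -∑ e : {e : Sym2 D // e.map Subtype.val ∈ lattice.edgeSet},
    w ⟨e.1.map Subtype.val, e.2⟩ * spinProduct ζ e.1

/-- The normalising constant `Z`. -/
def partitionFunction (β : ℝ) (w : Interaction) (C : Finset Vertex)
    (τ : outerBoundary C → Spin) : ℝ :=
  ∑ ζ ∈ configsWithBoundary C τ, Real.exp (-β * hamiltonian w (closedRegion C) ζ)

/-- The Boltzmann-Gibbs probability of the configuration `ζ` on `C̄`, given interactions `w` and
boundary condition `τ` on `∂Cᶜ`, at inverse temperature `β`. -/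
def gibbsProb (β : ℝ) (w : Interaction) (C : Finset Vertex) (τ : outerBoundary C → Spin)
    (ζ : closedRegion C → Spin) : ℝ :=
  if ζ ∈ configsWithBoundary C τ then
    Real.exp (-β * hamiltonian w (closedRegion C) ζ) / partitionFunction β w C τ
  else 0

/-! Edwards-Anderson spin glass distributions -/

/-- Joint configurations `(w, σ)` of interactions and spins. -/
abbrev Config : Type := Interaction × SpinConfig

/-- The σ-algebra generated by all the interactions and by the spins outside `C`. -/
@[reducible] def outsideSigma (C : Finset Vertex) : MeasurableSpace Config :=
  MeasurableSpace.comap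
    (fun p : Config => (p.1, fun x : {x : Vertex // x ∉ C} => p.2 x.1)) inferInstance

theorem outsideSigma_le (C : Finset Vertex) :
    outsideSigma C ≤ (inferInstance : MeasurableSpace Config) := by
  refine Measurable.comap_le ?_
  fun_prop

/-- `ν` is an Edwards-Anderson spin glass distribution at inverse temperature `β`: the interactions
are i.i.d. standard normal, and for every finite `C` the conditional law of the spins on `C̄`, given
the interactions and the spins outside `C`, is the Boltzmann-Gibbs distribution. (That law lives on
a finite set and is given by its values on single configurations `ζ`.) -/
structure IsEADistribution (β : ℝ) (ν : Measure Config) : Prop where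
  isProbabilityMeasure : IsProbabilityMeasure ν
  interaction_law : ∀ e : Edge, ν.map (fun p => p.1 e) = gaussianReal 0 1
  interaction_indep : iIndepFun (fun (e : Edge) (p : Config) => p.1 e) ν
  gibbs : ∀ (C : Finset Vertex) (ζ : closedRegion C → Spin),
    ν⟦{p : Config | (fun x : closedRegion C => p.2 x.1) = ζ} | outsideSigma C⟧
      =ᵐ[ν] fun p => gibbsProb β p.1 C (fun x => p.2 x.1) ζ

/-- Translation of an edge by the vector `t`. -/
def translateEdge (t : Vertex) (e : Edge) : Edge :=
  ⟨e.1.map (fun x => x + t), by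
    obtain ⟨e, he⟩ := e
    induction e with
    | h x y => simpa [lattice] using he⟩

/-- Translation by `t`, acting diagonally on interactions and spins. -/
def translateConfig (t : Vertex) (p : Config) : Config :=
  (fun e => p.1 (translateEdge t e), fun x => p.2 (x + t))

/-- Invariance of a joint distribution under all translations of `ℤ²`. -/
def IsTranslationInvariant (ν : Measure Config) : Prop :=
  ∀ t : Vertex, ν.map (translateConfig t) = ν

/-! The dual lattice and unsatisfied cycles -/

/-- Vertices of the dual lattice `(1/2, 1/2) + ℤ²`; the pair `a = (m, n)` stands for the point
`(m + 1/2, n + 1/2)`, the centre of the unit face with lower left corner `a`. -/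
abbrev DualVertex : Type := ℤ × ℤ

/-- The dual lattice: dual vertices are joined when their `ℓ¹` distance is `1`. -/
def dualLattice : SimpleGraph DualVertex where
  Adj a b := |a.1 - b.1| + |a.2 - b.2| = 1
  symm := ⟨fun a b h => by rw [abs_sub_comm b.1, abs_sub_comm b.2]; exact h⟩
  loopless := ⟨fun a h => by simp at h⟩

/-- The edge of `ℤ²` that crosses the dual edge `{a, b}`: its ends are the two common corners
`a ⊔ b` and `a ⊓ b + (1, 1)` of the faces centred at the dual vertices `a` and `b`. -/
def crossingEdge (e : dualLattice.edgeSet) : Edge :=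
  ⟨s(e.1.sup, e.1.inf + (1, 1)), by
    obtain ⟨e, he⟩ := e
    induction e with
    | h a b =>
      obtain ⟨a₁, a₂⟩ := a
      obtain ⟨b₁, b₂⟩ := b
      simp only [dualLattice, lattice, SimpleGraph.mem_edgeSet, Sym2.sup_mk, Sym2.inf_mk,
        Prod.mk_sup_mk, Prod.mk_inf_mk, Prod.mk_add_mk] at he ⊢
      grind⟩

/-- The edge `e = {x, y}` is unsatisfied when `w_e σ_x σ_y < 0`. -/
def IsUnsatisfied (p : Config) (e : Edge) : Prop :=
  p.1 e * spinProduct p.2 e.1 < 0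

/-- A dual edge is unsatisfied when the edge crossing it is. -/
def IsUnsatisfiedDual (p : Config) (e : dualLattice.edgeSet) : Prop :=
  IsUnsatisfied p (crossingEdge e)

/-- A dual cycle: a nontrivial closed path in the dual lattice that uses no edge twice.
It may visit a vertex more than once, so simple cycles are included. -/
structure DualCycle where
  base : DualVertex
  walk : dualLattice.Walk base base
  isCircuit : walk.IsCircuit

/-- The cycle passes through the dual vertex `a`. -/
def DualCycle.PassesThrough (γ : DualCycle) (a : DualVertex) : Prop :=
  a ∈ γ.walk.support

/-- All the edges of the cycle are unsatisfied. -/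
def DualCycle.IsUnsatisfied (γ : DualCycle) (p : Config) : Prop :=
  ∀ (e : Sym2 DualVertex) (he : e ∈ γ.walk.edges),
    IsUnsatisfiedDual p ⟨e, γ.walk.edges_subset_edgeSet he⟩

end EdwardsAnderson

end

open scoped ENNReal

namespace EdwardsAnderson

/-! Dual circuits as boundaries of finite sets -/

/-! This is the Peierls argument. A closed dual trail crosses exactly the edges leaving some finite
set `C`, namely the vertices around which it winds an odd number of times
(`exists_isCut_iff_mem_edges`). If all these edges are unsatisfied, reversing the spins in `C`
satisfies them and changes no other bond, so the energy drops by twice the sum of `|w e|` over the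
cut. Since the reversal is a bijection preserving the boundary condition, the event has conditional
probability at most the product of `exp (-2β|w e|)`, given the interactions and the spins outside
`C`.

Averaging over the independent Gaussians yields `r ^ n` for a trail of length `n`, with `r = E exp
(-2β|g|)` (`measureReal_forall_isUnsatisfied_le`). As `β` grows, `r` tends to `0`, so it eventually
beats the at most `4 ^ n` walks of length `n` from a given dual vertex. Borel-Cantelli then bounds
the lengths of the unsatisfied circuits through that vertex. -/

/-- The edges of `ℤ²` with exactly one end in `C`. -/
def IsCut (C : Set Vertex) (e : Sym2 Vertex) : Prop := ∃ x ∈ C, ∃ y ∉ C, e = s(x, y)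

theorem isCut_mk {C : Set Vertex} {x y : Vertex} :
    IsCut C s(x, y) ↔ ¬(x ∈ C ↔ y ∈ C) := by
  constructor
  · rintro ⟨a, ha, b, hb, h⟩
    rcases Sym2.eq_iff.1 h with ⟨rfl, rfl⟩ | ⟨rfl, rfl⟩ <;> tauto
  · intro h
    by_cases hx : x ∈ C
    · exact ⟨x, hx, y, by tauto, rfl⟩
    · exact ⟨y, by tauto, x, hx, Sym2.eq_swap⟩

theorem lattice_adj_cases {x y : Vertex} (h : lattice.Adj x y) :
    y = (x.1 + 1, x.2) ∨ x = (y.1 + 1, y.2) ∨ y = (x.1, x.2 + 1) ∨ x = (y.1, y.2 + 1) := by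
  obtain ⟨a, b⟩ := x
  obtain ⟨c, d⟩ := y
  simp only [lattice, Prod.mk.injEq] at h ⊢
  grind

/-- The pair of dual vertices joined by the dual edge that crosses an edge of `ℤ²`. -/
def dualPair (e : Sym2 Vertex) : Sym2 DualVertex := s(e.sup - (1, 1), e.inf)

theorem dualPair_crossingEdge (e : dualLattice.edgeSet) :
    dualPair (crossingEdge e).1 = e.1 := by
  obtain ⟨e, he⟩ := e
  induction e with
  | h a b =>
    have he' : lattice.Adj a b := he
    rcases lattice_adj_cases he' with h | h | h | h <;> subst h <;>
      simp [dualPair, crossingEdge, Prod.ext_iff]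

theorem crossingEdge_injective : Function.Injective crossingEdge := fun e f h =>
  Subtype.ext (by rw [← dualPair_crossingEdge e, ← dualPair_crossingEdge f, h])

theorem dualPair_mem (e : Edge) : dualPair e.1 ∈ dualLattice.edgeSet := by
  obtain ⟨e, he⟩ := e
  induction e with
  | h x y =>
    have he' : lattice.Adj x y := he
    rcases lattice_adj_cases he' with h | h | h | h <;> subst h <;>
      simp [dualPair, dualLattice]

theorem crossingEdge_dualPair (e : Edge) : crossingEdge ⟨dualPair e.1, dualPair_mem e⟩ = e := by
  obtain ⟨e, he⟩ := e
  apply Subtype.ext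
  induction e with
  | h x y =>
    have he' : lattice.Adj x y := he
    rcases lattice_adj_cases he' with h | h | h | h <;> subst h <;>
      simp [dualPair, crossingEdge, Prod.ext_iff]

/-- The sum telescopes mod 2. For a closed walk it vanishes: every vertex set is entered and left an
even number of times in all. Ray parities can thus be corrected by such sums for free. -/
theorem sum_darts_add {V : Type*} {G : SimpleGraph V} (g : V → ZMod 2) {u v : V}
    (p : G.Walk u v) : (p.darts.map fun d => g d.fst + g d.snd).sum = g u + g v := by
  induction p with
  | nil => simp [CharTwo.add_self_eq_zero]
  | cons h p ih =>
    rename_i a b c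
    simp only [SimpleGraph.Walk.darts_cons, List.map_cons, List.sum_cons, ih]
    have := CharTwo.add_self_eq_zero (g b)
    linear_combination this

theorem sum_darts_eq {V : Type*} [DecidableEq V] {G : SimpleGraph V} {u v : V} {p : G.Walk u v}
    (hp : p.IsTrail) (e : Sym2 V) :
    (p.darts.map fun d => if d.edge = e then (1 : ZMod 2) else 0).sum =
      if e ∈ p.edges then 1 else 0 := by
  induction p with
  | nil => simp
  | cons h p ih =>
    rw [SimpleGraph.Walk.isTrail_cons] at hp
    simp only [SimpleGraph.Walk.darts_cons, List.map_cons, List.sum_cons, ih hp.1,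
      SimpleGraph.Walk.edges_cons, List.mem_cons, SimpleGraph.Dart.edge_mk]
    grind

/-- The vertical dual edges that cross the horizontal ray to the right of `x`. -/
def IsRayEdge (x : Vertex) (a b : DualVertex) : Prop :=
  x.1 ≤ a.1 ∧ a.1 = b.1 ∧ (a.2 = x.2 ∧ b.2 = x.2 - 1 ∨ b.2 = x.2 ∧ a.2 = x.2 - 1)

open Classical in
/-- The parity of the number of crossings of a dual walk with the ray to the right of `x`. -/
noncomputable def rayParity {a b : DualVertex} (p : dualLattice.Walk a b) (x : Vertex) : ZMod 2 :=
  (p.darts.map fun d => if IsRayEdge x d.fst d.snd then 1 else 0).sum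

theorem rayParity_horizontal {a b : DualVertex} {p : dualLattice.Walk a b} (hp : p.IsTrail)
    (x : Vertex) :
    rayParity p x + rayParity p (x.1 + 1, x.2) =
      if s((x.1, x.2 - 1), (x.1, x.2)) ∈ p.edges then 1 else 0 := by
  classical
  rw [← sum_darts_eq hp, rayParity, rayParity, ← List.sum_map_add]
  congr 1
  refine List.map_congr_left fun d _ => ?_
  obtain ⟨⟨⟨a1, a2⟩, ⟨b1, b2⟩⟩, hd⟩ := d
  obtain ⟨x1, x2⟩ := x
  have h2 : (1 + 1 : ZMod 2) = 0 := by decide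
  simp only [IsRayEdge, SimpleGraph.Dart.edge_mk, Sym2.eq_iff, Prod.mk.injEq]
  grind

theorem rayParity_vertical {a : DualVertex} {p : dualLattice.Walk a a} (hp : p.IsTrail)
    (x : Vertex) :
    rayParity p x + rayParity p (x.1, x.2 + 1) =
      if s((x.1 - 1, x.2), (x.1, x.2)) ∈ p.edges then 1 else 0 := by
  classical
  -- The half-row of dual vertices between the two rays is left by edges across the lower ray,
  -- across the upper ray, and by one edge at its left end. A closed walk uses these an even number
  -- of times in total.
  have h := sum_darts_add (fun c : DualVertex => if x.1 ≤ c.1 ∧ c.2 = x.2 then 1 else 0) p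
  rw [CharTwo.add_self_eq_zero] at h
  rw [← sum_darts_eq hp, ← add_zero (rayParity p x + _), ← h, rayParity, rayParity,
    ← List.sum_map_add, ← List.sum_map_add]
  congr 1
  refine List.map_congr_left fun d _ => ?_
  obtain ⟨⟨a, b⟩, hd⟩ := d
  have h2 : (1 + 1 : ZMod 2) = 0 := by decide
  have hd' : lattice.Adj a b := hd
  obtain ⟨x1, x2⟩ := x
  simp only [IsRayEdge, SimpleGraph.Dart.edge_mk, Sym2.eq_iff]
  rcases lattice_adj_cases hd' with h | h | h | h <;> subst h <;>
  · simp only [Prod.ext_iff]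
    grind

theorem exists_bound {a b : DualVertex} (p : dualLattice.Walk a b) :
    ∃ M : ℤ, ∀ c ∈ p.support, |c.1| ≤ M ∧ |c.2| ≤ M := by
  induction p with
  | nil =>
    rename_i u
    exact ⟨max |u.1| |u.2|, by simp⟩
  | cons h p ih =>
    rename_i u v w
    obtain ⟨M, hM⟩ := ih
    refine ⟨max M (max |u.1| |u.2|), fun c hc => ?_⟩
    rw [SimpleGraph.Walk.support_cons, List.mem_cons] at hc
    rcases hc with rfl | hc
    · simp
    · have := hM c hc
      simp [this]

theorem finite_rayParity {a : DualVertex} (p : dualLattice.Walk a a) :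
    {x : Vertex | rayParity p x ≠ 0}.Finite := by
  classical
  obtain ⟨M, hM⟩ := exists_bound p
  refine (Finset.finite_toSet (Finset.Icc ((-M, -M) : ℤ × ℤ) (M, M + 1))).subset fun x hx => ?_
  rw [Set.mem_ofPred_eq] at hx
  have key : ∃ d ∈ p.darts, IsRayEdge x d.fst d.snd := by
    by_contra! hne
    refine hx (List.sum_eq_zero fun y hy => ?_)
    obtain ⟨d, hd, rfl⟩ := List.mem_map.1 hy
    simp [hne d hd]
  obtain ⟨d, hd, h1, h2, h3⟩ := key
  have ha := hM _ (p.dart_fst_mem_support_of_mem_darts hd)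
  have hb := hM _ (p.dart_snd_mem_support_of_mem_darts hd)
  have hleft : -M ≤ x.1 := by
    by_contra! hlt
    refine hx ?_
    -- For `x` to the left of the whole walk, crossing the ray is the same as crossing the boundary
    -- of the half-plane above it, which a closed walk does an even number of times.
    have h := sum_darts_add (fun c : DualVertex => if x.2 ≤ c.2 then 1 else 0) p
    rw [CharTwo.add_self_eq_zero] at h
    rw [← h, rayParity]
    congr 1
    refine List.map_congr_left fun d hd => ?_
    have ha := hM _ (p.dart_fst_mem_support_of_mem_darts hd)
    have hb := hM _ (p.dart_snd_mem_support_of_mem_darts hd)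
    obtain ⟨⟨a, b⟩, hd'⟩ := d
    have h2 : (1 + 1 : ZMod 2) = 0 := by decide
    replace hd' : lattice.Adj a b := hd'
    simp only [IsRayEdge] at ha hb ⊢
    rw [abs_le, abs_le] at ha hb
    rcases lattice_adj_cases hd' with h | h | h | h <;> subst h <;> grind
  rw [abs_le, abs_le] at ha hb
  simp only [Finset.coe_Icc, Set.mem_Icc, Prod.le_def]
  grind

/-- The edges of `ℤ²` crossed by a dual circuit are those between a finite set and its
complement. -/
theorem exists_isCut_iff_mem_edges {a : DualVertex} {p : dualLattice.Walk a a} (hp : p.IsTrail) :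
    ∃ C : Finset Vertex, ∀ e : Edge, IsCut C e.1 ↔ dualPair e.1 ∈ p.edges := by
  classical
  -- `C` consists of the vertices of odd ray parity; the parity changes along an edge exactly when
  -- the trail crosses it.
  refine ⟨(finite_rayParity p).toFinset, fun e => ?_⟩
  have hz : ∀ s t : ZMod 2, (¬(s ≠ 0 ↔ t ≠ 0)) ↔ s + t = 1 := by decide
  have hor (x : Vertex) : rayParity p x + rayParity p (x.1 + 1, x.2) = 1 ↔
      dualPair s(x, (x.1 + 1, x.2)) ∈ p.edges := by
    have : dualPair s(x, (x.1 + 1, x.2)) = s((x.1, x.2 - 1), (x.1, x.2)) := by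
      simp [dualPair, Prod.le_def]
    rw [rayParity_horizontal hp, this]
    split_ifs with h <;> simp [h]
  have ver (x : Vertex) : rayParity p x + rayParity p (x.1, x.2 + 1) = 1 ↔
      dualPair s(x, (x.1, x.2 + 1)) ∈ p.edges := by
    have : dualPair s(x, (x.1, x.2 + 1)) = s((x.1 - 1, x.2), (x.1, x.2)) := by
      simp [dualPair, Prod.le_def]
    rw [rayParity_vertical hp, this]
    split_ifs with h <;> simp [h]
  obtain ⟨e, he⟩ := e
  induction e with
  | h x y =>
    have he' : lattice.Adj x y := he
    simp only [Set.Finite.coe_toFinset, isCut_mk, Set.mem_ofPred_eq, hz]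
    rcases lattice_adj_cases he' with h | h | h | h <;> rw [h]
    · exact hor x
    · rw [add_comm, Sym2.eq_swap]; exact hor y
    · exact ver x
    · rw [add_comm, Sym2.eq_swap]; exact ver y

open Classical in
/-- The edges of `ℤ²` crossed by a dual walk. -/
noncomputable def crossedEdges {a b : DualVertex} (p : dualLattice.Walk a b) : Finset Edge :=
  (p.edges.toFinset.subtype (· ∈ dualLattice.edgeSet)).map ⟨crossingEdge, crossingEdge_injective⟩

theorem mem_crossedEdges {a b : DualVertex} {p : dualLattice.Walk a b} {e : Edge} :
    e ∈ crossedEdges p ↔ dualPair e.1 ∈ p.edges := by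
  simp only [crossedEdges, Finset.mem_map, Finset.mem_subtype, List.mem_toFinset,
    Function.Embedding.coeFn_mk]
  constructor
  · rintro ⟨f, hf, rfl⟩
    rwa [dualPair_crossingEdge]
  · exact fun h => ⟨⟨dualPair e.1, dualPair_mem e⟩, h, crossingEdge_dualPair e⟩

theorem card_crossedEdges {a b : DualVertex} {p : dualLattice.Walk a b} (hp : p.IsTrail) :
    (crossedEdges p).card = p.length := by
  classical
  rw [crossedEdges, Finset.card_map, Finset.card_subtype, Finset.filter_true_of_mem,
    List.toFinset_card_of_nodup hp.edges_nodup, SimpleGraph.Walk.length_edges]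
  exact fun e he => p.edges_subset_edgeSet (List.mem_toFinset.1 he)

/-! ### Counting dual walks -/

noncomputable instance : dualLattice.LocallyFinite := fun a =>
  Fintype.ofFinset (neighbors a) fun _ => mem_neighbors

theorem card_finsetWalkLength_le (n : ℕ) (a b : DualVertex) :
    (dualLattice.finsetWalkLength n a b).card ≤ 4 ^ n := by
  induction n generalizing a with
  | zero =>
    unfold SimpleGraph.finsetWalkLength
    split_ifs with h
    · subst h; simp
    · simp
  | succ n ih =>
    unfold SimpleGraph.finsetWalkLength
    refine Finset.card_biUnion_le.trans ?_
    simp only [Finset.card_map]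
    refine (Finset.sum_le_card_nsmul Finset.univ _ (4 ^ n) fun w _ => ih w.1).trans ?_
    have : (Finset.univ : Finset (dualLattice.neighborSet a)).card ≤ 4 := by
      rw [Finset.card_univ]
      exact (Fintype.card_ofFinset (p := dualLattice.neighborSet a) (neighbors a)
        fun _ => mem_neighbors).trans_le Finset.card_le_four
    rw [smul_eq_mul, pow_succ']
    exact Nat.mul_le_mul_right _ this

/-! The Peierls bound -/

theorem spinProduct_mk {V : Type*} (σ : V → Spin) (x y : V) :
    spinProduct σ s(x, y) = ((σ x : ℤ) : ℝ) * ((σ y : ℤ) : ℝ) := by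
  simp [spinProduct]

theorem spinProduct_map {V W : Type*} (σ : W → Spin) (f : V → W) (e : Sym2 V) :
    spinProduct σ (e.map f) = spinProduct (fun x => σ (f x)) e := by
  simp only [spinProduct, Sym2.map_map]
  rfl

theorem abs_spinProduct {V : Type*} (σ : V → Spin) (e : Sym2 V) : |spinProduct σ e| = 1 := by
  unfold spinProduct
  rcases Int.units_eq_one_or ((e.map σ).mul) with h | h <;> simp [h]

/-- The edges of `ℤ²` with both ends in `D`. -/
abbrev InnerEdge (D : Finset Vertex) : Type :=
  {e : Sym2 D // e.map Subtype.val ∈ lattice.edgeSet}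

/-- An edge with both ends in `D`, seen as an edge of `ℤ²`. -/
def InnerEdge.toEdge {D : Finset Vertex} (e : InnerEdge D) : Edge :=
  ⟨e.1.map Subtype.val, e.2⟩

theorem InnerEdge.toEdge_injective {D : Finset Vertex} :
    Function.Injective (InnerEdge.toEdge (D := D)) := fun _ _ h =>
  Subtype.ext (Sym2.map.injective Subtype.val_injective (congrArg Subtype.val h))

/-- Ensures that the energy on `closedRegion C` contains a term for every cut edge. -/
theorem exists_toEdge_eq {C : Finset Vertex} {e : Edge} (he : IsCut C e.1) :
    ∃ f : InnerEdge (closedRegion C), f.toEdge = e := by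
  obtain ⟨e, he'⟩ := e
  obtain ⟨x, hx, y, hy, rfl : e = s(x, y)⟩ := he
  have hx' : x ∈ closedRegion C := Finset.mem_union_left _ hx
  have hy' : y ∈ closedRegion C :=
    Finset.mem_union_right _ (mem_outerBoundary.2 ⟨hy, x, hx, (lattice.mem_edgeSet.1 he').symm⟩)
  exact ⟨⟨s(⟨x, hx'⟩, ⟨y, hy'⟩), he'⟩, rfl⟩

/-- Reversal of the spins in `C`. -/
def flipSpins (C : Finset Vertex) (ζ : closedRegion C → Spin) : closedRegion C → Spin :=
  fun x => if x.1 ∈ C then -ζ x else ζ x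

theorem flipSpins_flipSpins (C : Finset Vertex) (ζ : closedRegion C → Spin) :
    flipSpins C (flipSpins C ζ) = ζ := by
  funext x
  unfold flipSpins
  split_ifs <;> simp

open Classical in
theorem spinProduct_flipSpins (C : Finset Vertex) (ζ : closedRegion C → Spin)
    (e : Sym2 (closedRegion C)) :
    spinProduct (flipSpins C ζ) e =
      if IsCut C (e.map Subtype.val) then -spinProduct ζ e else spinProduct ζ e := by
  induction e with
  | h x y =>
    rw [Sym2.map_mk, isCut_mk, spinProduct_mk, spinProduct_mk]
    simp only [flipSpins, Finset.mem_coe]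
    by_cases hx : x.1 ∈ C <;> by_cases hy : y.1 ∈ C <;> simp [hx, hy]

theorem flipSpins_mem_configsWithBoundary {C : Finset Vertex} {τ : outerBoundary C → Spin}
    {ζ : closedRegion C → Spin} :
    flipSpins C ζ ∈ configsWithBoundary C τ ↔ ζ ∈ configsWithBoundary C τ := by
  have (x : outerBoundary C) : flipSpins C ζ (boundaryIncl x) = ζ (boundaryIncl x) :=
    if_neg (mem_outerBoundary.1 x.2).1
  simp [configsWithBoundary, this]

/-- Every edge that leaves `C` is unsatisfied in the configuration `ζ`. -/
def CutUnsatisfied (C : Finset Vertex) (ζ : closedRegion C → Spin) (w : Interaction) : Prop :=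
  ∀ e : InnerEdge (closedRegion C), IsCut C e.toEdge.1 → w e.toEdge * spinProduct ζ e.1 < 0

/-- Only cut terms change sign under the reversal, and an unsatisfied edge goes from contributing
`|w e|` to contributing `-|w e|`. -/
theorem hamiltonian_eq_add {C : Finset Vertex} {S : Finset Edge}
    (hS : ∀ e : Edge, e ∈ S ↔ IsCut C e.1) {w : Interaction} {ζ : closedRegion C → Spin}
    (h : CutUnsatisfied C ζ w) :
    hamiltonian w (closedRegion C) ζ =
      2 * ∑ e ∈ S, |w e| + hamiltonian w (closedRegion C) (flipSpins C ζ) := by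
  classical
  have h1 : ∑ e ∈ S, |w e| =
      ∑ e : InnerEdge (closedRegion C), if IsCut C e.toEdge.1 then |w e.toEdge| else 0 := by
    rw [← Finset.sum_filter]
    symm
    refine Finset.sum_bij (fun e _ => e.toEdge) ?_ ?_ ?_ ?_
    · intro e he
      exact (hS _).2 (Finset.mem_filter.1 he).2
    · intro e _ f _ hef
      exact InnerEdge.toEdge_injective hef
    · intro e he
      obtain ⟨f, rfl⟩ := exists_toEdge_eq ((hS e).1 he)
      exact ⟨f, Finset.mem_filter.2 ⟨Finset.mem_univ _, (hS _).1 he⟩, rfl⟩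
    · intro e _
      rfl
  rw [h1, hamiltonian, hamiltonian, Finset.mul_sum, ← sub_eq_iff_eq_add, neg_sub_neg,
    ← Finset.sum_sub_distrib]
  refine Finset.sum_congr rfl fun (e : InnerEdge (closedRegion C)) _ => ?_
  change w e.toEdge * spinProduct (flipSpins C ζ) e.1 - w e.toEdge * spinProduct ζ e.1 = _
  rw [spinProduct_flipSpins]
  change w e.toEdge * (if IsCut C e.toEdge.1 then _ else _) - _ = _
  split_ifs with hc
  · have h2 : |w e.toEdge| = -(w e.toEdge * spinProduct ζ e.1) := by
      rw [← abs_of_neg (h e hc), abs_mul, abs_spinProduct, mul_one]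
    rw [h2]
    ring
  · ring

theorem gibbsProb_nonneg (β : ℝ) (w : Interaction) (C : Finset Vertex)
    (τ : outerBoundary C → Spin) (ζ : closedRegion C → Spin) : 0 ≤ gibbsProb β w C τ ζ := by
  unfold gibbsProb
  split_ifs
  · exact div_nonneg (Real.exp_nonneg _) (Finset.sum_nonneg fun _ _ => Real.exp_nonneg _)
  · exact le_rfl

theorem sum_gibbsProb_le_one (β : ℝ) (w : Interaction) (C : Finset Vertex)
    (τ : outerBoundary C → Spin) : ∑ ζ, gibbsProb β w C τ ζ ≤ 1 := by
  unfold gibbsProb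
  rw [← Finset.sum_filter, Finset.filter_mem_eq_inter, Finset.univ_inter, ← Finset.sum_div]
  exact div_self_le_one _

theorem gibbsProb_eq_mul {C : Finset Vertex} {S : Finset Edge}
    (hS : ∀ e : Edge, e ∈ S ↔ IsCut C e.1) (β : ℝ) {w : Interaction}
    (τ : outerBoundary C → Spin) {ζ : closedRegion C → Spin} (h : CutUnsatisfied C ζ w) :
    gibbsProb β w C τ ζ =
      (∏ e ∈ S, Real.exp (-2 * β * |w e|)) * gibbsProb β w C τ (flipSpins C ζ) := by
  unfold gibbsProb
  simp only [flipSpins_mem_configsWithBoundary]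
  split_ifs
  · rw [hamiltonian_eq_add hS h, ← Real.exp_sum, ← mul_div_assoc, ← Real.exp_add, ← Finset.mul_sum]
    congr 2
    ring
  · simp

-- Each bad configuration is charged to its reversal; reversal is injective, so the charged weights
-- add up to at most one.
open Classical in
theorem sum_gibbsProb_cutUnsatisfied_le {C : Finset Vertex} {S : Finset Edge}
    (hS : ∀ e : Edge, e ∈ S ↔ IsCut C e.1) (β : ℝ) (w : Interaction)
    (τ : outerBoundary C → Spin) :
    (∑ ζ, if CutUnsatisfied C ζ w then gibbsProb β w C τ ζ else 0) ≤
      ∏ e ∈ S, Real.exp (-2 * β * |w e|) := by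
  have h0 : 0 ≤ ∏ e ∈ S, Real.exp (-2 * β * |w e|) :=
    Finset.prod_nonneg fun _ _ => Real.exp_nonneg _
  calc
    _ ≤ ∑ ζ, (∏ e ∈ S, Real.exp (-2 * β * |w e|)) * gibbsProb β w C τ (flipSpins C ζ) := by
      refine Finset.sum_le_sum fun ζ _ => ?_
      split_ifs with h
      · exact (gibbsProb_eq_mul hS β τ h).le
      · exact mul_nonneg h0 (gibbsProb_nonneg _ _ _ _ _)
    _ = (∏ e ∈ S, Real.exp (-2 * β * |w e|)) * ∑ ζ, gibbsProb β w C τ ζ := by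
      rw [← Finset.mul_sum]
      congr 1
      exact Fintype.sum_equiv (Function.Involutive.toPerm _ (flipSpins_flipSpins C)) _ _
        fun _ => rfl
    _ ≤ _ := mul_le_of_le_one_right h0 (sum_gibbsProb_le_one _ _ _ _)

theorem measurableSet_cutUnsatisfied (C : Finset Vertex) (ζ : closedRegion C → Spin) :
    MeasurableSet {w : Interaction | CutUnsatisfied C ζ w} := by
  unfold CutUnsatisfied
  simp only [Set.ofPred_forall]
  refine MeasurableSet.iInter fun e => MeasurableSet.iInter fun _ => measurableSet_lt ?_ ?_ <;>
    fun_prop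

theorem integral_prod_exp {β : ℝ} {ν : Measure Config} (hν : IsEADistribution β ν)
    (S : Finset Edge) (c : ℝ) :
    ∫ p, ∏ e ∈ S, Real.exp (c * |p.1 e|) ∂ν =
      (∫ x, Real.exp (c * |x|) ∂gaussianReal 0 1) ^ S.card := by
  have hind := hν.interaction_indep.precomp (g := ((↑) : S → Edge)) Subtype.val_injective
  have hm : Measurable fun x : ℝ => Real.exp (c * |x|) := by fun_prop
  have h := hind.integral_fun_prod_comp (f := fun _ x => Real.exp (c * |x|))
    (fun e => (by fun_prop : Measurable fun p : Config => p.1 e.1).aemeasurable)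
    (fun _ => hm.aestronglyMeasurable)
  have h1 (p : Config) : ∏ e ∈ S, Real.exp (c * |p.1 e|) =
      ∏ e : S, Real.exp (c * |p.1 e.1|) := (Finset.prod_coe_sort S _).symm
  simp only [h1]
  refine h.trans ?_
  rw [← Fintype.card_coe, ← Finset.card_univ, ← Finset.prod_const]
  refine Finset.prod_congr rfl fun e _ => ?_
  rw [← hν.interaction_law e.1, integral_map (Measurable.aemeasurable (by fun_prop))
    hm.aestronglyMeasurable]

/-- The Peierls bound: the edges leaving a finite set are all unsatisfied with exponentially small
probability. -/
theorem measureReal_forall_isUnsatisfied_le {β : ℝ} (hβ : 0 ≤ β) {ν : Measure Config}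
    (hν : IsEADistribution β ν) {C : Finset Vertex} {S : Finset Edge}
    (hS : ∀ e : Edge, e ∈ S ↔ IsCut C e.1) :
    ν.real {p | ∀ e ∈ S, IsUnsatisfied p e} ≤
      (∫ x, Real.exp (-2 * β * |x|) ∂gaussianReal 0 1) ^ S.card := by
  classical
  have := hν.isProbabilityMeasure
  let E (ζ : closedRegion C → Spin) : Set Config :=
    {p | (fun x : closedRegion C => p.2 x.1) = ζ}
  let B (ζ : closedRegion C → Spin) : Set Config := Prod.fst ⁻¹' {w | CutUnsatisfied C ζ w}
  let g (ζ : closedRegion C → Spin) (p : Config) : ℝ :=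
    gibbsProb β p.1 C (fun x => p.2 x.1) ζ
  have hE (ζ) : MeasurableSet (E ζ) :=
    (by fun_prop : Measurable fun (p : Config) (x : closedRegion C) => p.2 x.1)
      (measurableSet_singleton ζ)
  have hB (ζ) : MeasurableSet[outsideSigma C] (B ζ) :=
    (measurable_fst.comp (comap_measurable fun p : Config =>
      (p.1, fun x : {x : Vertex // x ∉ C} => p.2 x.1))) (measurableSet_cutUnsatisfied C ζ)
  have hB' (ζ) : MeasurableSet (B ζ) := outsideSigma_le C _ (hB ζ)
  have hg (ζ) : Integrable (g ζ) ν := integrable_condExp.congr (hν.gibbs C ζ)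
  -- `B ζ` depends on the interactions alone, so it belongs to `outsideSigma C` and the conditional
  -- probability of `E ζ` may be integrated over it.
  have hEB (ζ) : ν.real (E ζ ∩ B ζ) = ∫ p, (if CutUnsatisfied C ζ p.1 then g ζ p else 0) ∂ν := by
    have h1 := setIntegral_condExp (μ := ν) (outsideSigma_le C)
      ((integrable_const (1 : ℝ)).indicator (hE ζ)) (hB ζ)
    rw [setIntegral_congr_ae (hB' ζ) ((hν.gibbs C ζ).mono fun p hp _ => hp),
      ← integral_indicator (hB' ζ), setIntegral_indicator (hE ζ)] at h1
    rw [setIntegral_const, smul_eq_mul, mul_one, Set.inter_comm] at h1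
    exact h1.symm
  have hsub : {p : Config | ∀ e ∈ S, IsUnsatisfied p e} ⊆ ⋃ ζ, E ζ ∩ B ζ := by
    intro p hp
    refine Set.mem_iUnion.2 ⟨fun x => p.2 x.1, rfl, fun e he => ?_⟩
    have := hp e.toEdge ((hS _).2 he)
    rwa [IsUnsatisfied, InnerEdge.toEdge, spinProduct_map] at this
  have hint (ζ) : Integrable (fun p : Config => if CutUnsatisfied C ζ p.1 then g ζ p else 0) ν :=
    (hg ζ).indicator (hB' ζ)
  have hmeas : Measurable fun p : Config => ∏ e ∈ S, Real.exp (-2 * β * |p.1 e|) := by fun_prop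
  calc
    _ ≤ ν.real (⋃ ζ, E ζ ∩ B ζ) := measureReal_mono hsub
    _ ≤ ∑ ζ, ν.real (E ζ ∩ B ζ) := measureReal_iUnion_fintype_le _
    _ = ∫ p, ∑ ζ, (if CutUnsatisfied C ζ p.1 then g ζ p else 0) ∂ν := by
      simp_rw [hEB]
      exact (integral_finsetSum _ fun ζ _ => hint ζ).symm
    _ ≤ ∫ p, ∏ e ∈ S, Real.exp (-2 * β * |p.1 e|) ∂ν := by
      refine integral_mono (integrable_finsetSum _ fun ζ _ => hint ζ) ?_ fun p =>
        sum_gibbsProb_cutUnsatisfied_le hS β p.1 _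
      refine Integrable.of_bound hmeas.aestronglyMeasurable 1 (.of_forall fun p => ?_)
      rw [Real.norm_of_nonneg (Finset.prod_nonneg fun _ _ => Real.exp_nonneg _)]
      refine Finset.prod_le_one (fun _ _ => Real.exp_nonneg _) fun e _ => ?_
      rw [Real.exp_le_one_iff]
      nlinarith [mul_nonneg hβ (abs_nonneg (p.1 e))]
    _ = _ := integral_prod_exp hν S _

/-- Dominated convergence: the integrand tends to `0` except at `x = 0`, a null point of the
Gaussian. -/
theorem tendsto_integral_exp_neg_abs :
    Filter.Tendsto (fun β : ℝ => ∫ x, Real.exp (-2 * β * |x|) ∂gaussianReal 0 1)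
      Filter.atTop (nhds 0) := by
  suffices h : Filter.Tendsto (fun β : ℝ => ∫ x, Real.exp (-2 * β * |x|) ∂gaussianReal 0 1)
      Filter.atTop (nhds (∫ _, (0 : ℝ) ∂gaussianReal 0 1)) by rwa [integral_zero] at h
  refine tendsto_integral_filter_of_dominated_convergence (fun _ => (1 : ℝ)) ?_ ?_
    (integrable_const (μ := gaussianReal 0 1) (1 : ℝ)) ?_
  · exact .of_forall fun β => (by fun_prop : Measurable _).aestronglyMeasurable
  · filter_upwards [Filter.eventually_ge_atTop 0] with β hβ
    refine .of_forall fun x => ?_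
    rw [Real.norm_of_nonneg (Real.exp_nonneg _), Real.exp_le_one_iff]
    nlinarith [mul_nonneg hβ (abs_nonneg x)]
  · have := nullSingletonClass_gaussianReal (μ := 0) (v := 1) one_ne_zero
    filter_upwards [compl_mem_ae_iff.2 (measure_singleton (μ := gaussianReal 0 1) (0 : ℝ))]
      with x hx
    have hx' : 0 < |x| := abs_pos.2 hx
    refine Real.tendsto_exp_atBot.comp ?_
    exact ((Filter.tendsto_id.const_mul_atTop_of_neg (by norm_num : (-2 : ℝ) < 0)).atBot_mul_const
      hx')

/-! Counting circuits and the Borel-Cantelli lemma -/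

/-- All the edges of a dual walk are unsatisfied. -/
def WalkUnsatisfied (p : Config) {a b : DualVertex} (q : dualLattice.Walk a b) : Prop :=
  ∀ (e : Sym2 DualVertex) (he : e ∈ q.edges), IsUnsatisfiedDual p ⟨e, q.edges_subset_edgeSet he⟩

theorem measure_walkUnsatisfied_le {β : ℝ} (hβ : 0 ≤ β) {ν : Measure Config}
    (hν : IsEADistribution β ν) {a : DualVertex} {q : dualLattice.Walk a a} (hq : q.IsTrail) :
    ν {p | WalkUnsatisfied p q} ≤
      ENNReal.ofReal ((∫ x, Real.exp (-2 * β * |x|) ∂gaussianReal 0 1) ^ q.length) := by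
  have := hν.isProbabilityMeasure
  obtain ⟨C, hC⟩ := exists_isCut_iff_mem_edges hq
  have h := measureReal_forall_isUnsatisfied_le hβ hν (S := crossedEdges q) (C := C)
    fun e => mem_crossedEdges.trans (hC e).symm
  rw [card_crossedEdges hq] at h
  refine (measure_mono fun p hp e he => ?_).trans
    ((ENNReal.le_ofReal_iff_toReal_le (measure_ne_top _ _)
      (pow_nonneg (integral_nonneg fun _ => Real.exp_nonneg _) _)).2 h)
  have := hp _ (mem_crossedEdges.1 he)
  rwa [IsUnsatisfiedDual, crossingEdge_dualPair] at this

/-- The event that an unsatisfied dual circuit of length `n` is based at `a`. -/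
def circuitEvent (a : DualVertex) (n : ℕ) : Set Config :=
  {p | ∃ q : dualLattice.Walk a a, q.IsTrail ∧ q.length = n ∧ WalkUnsatisfied p q}

/-- The threshold `1 / 8` is chosen so that the `4 ^ n` walks leave a summable `(1 / 2) ^ n`. -/
theorem measure_circuitEvent_le {β : ℝ} (hβ : 0 ≤ β) {ν : Measure Config}
    (hν : IsEADistribution β ν)
    (hsmall : ∫ x, Real.exp (-2 * β * |x|) ∂gaussianReal 0 1 ≤ 1 / 8)
    (a : DualVertex) (n : ℕ) : ν (circuitEvent a n) ≤ (1 / 2) ^ n := by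
  classical
  have hsub : circuitEvent a n ⊆ ⋃ q ∈ (dualLattice.finsetWalkLength n a a).filter (·.IsTrail),
      {p | WalkUnsatisfied p q} := by
    rintro p ⟨q, hq, hn, hp⟩
    exact Set.mem_biUnion (Finset.mem_filter.2
      ⟨SimpleGraph.mem_finsetWalkLength_iff.2 hn, hq⟩) hp
  have hone {q : dualLattice.Walk a a}
      (hq : q ∈ (dualLattice.finsetWalkLength n a a).filter (·.IsTrail)) :
      ν {p | WalkUnsatisfied p q} ≤ (1 / 8) ^ n := by
    obtain ⟨hn, ht⟩ := Finset.mem_filter.1 hq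
    rw [SimpleGraph.mem_finsetWalkLength_iff] at hn
    refine (measure_walkUnsatisfied_le hβ hν ht).trans ?_
    rw [hn, ENNReal.ofReal_pow (integral_nonneg fun _ => Real.exp_nonneg _)]
    gcongr
    refine (ENNReal.ofReal_le_ofReal hsmall).trans_eq ?_
    rw [ENNReal.ofReal_div_of_pos (by norm_num)]
    simp
  calc
    ν (circuitEvent a n) ≤ _ := measure_mono hsub
    _ ≤ _ := measure_biUnion_finset_le _ _
    _ ≤ _ := Finset.sum_le_card_nsmul _ _ _ fun q hq => hone hq
    _ ≤ (4 ^ n : ℕ) * (1 / 8 : ℝ≥0∞) ^ n := by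
      rw [nsmul_eq_mul]
      gcongr
      exact (Finset.card_filter_le _ _).trans (card_finsetWalkLength_le n a a)
    _ = (1 / 2) ^ n := by
      push_cast
      rw [← mul_pow]
      congr 1
      rw [← ENNReal.toReal_eq_toReal_iff' (by finiteness) (by finiteness)]
      norm_num

theorem ae_eventually_notMem_circuitEvent {β : ℝ} (hβ : 0 ≤ β) {ν : Measure Config}
    (hν : IsEADistribution β ν)
    (hsmall : ∫ x, Real.exp (-2 * β * |x|) ∂gaussianReal 0 1 ≤ 1 / 8) :
    ∀ᵐ p ∂ν, ∀ a, ∀ᶠ n in Filter.atTop, p ∉ circuitEvent a n := by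
  refine ae_all_iff.2 fun a => ae_eventually_notMem (ne_top_of_le_ne_top ?_
    (ENNReal.tsum_le_tsum (measure_circuitEvent_le hβ hν hsmall a)))
  rw [ENNReal.tsum_geometric, ENNReal.inv_ne_top]
  simp

theorem abs_sub_le_length {a b : DualVertex} (q : dualLattice.Walk a b) :
    |a.1 - b.1| ≤ q.length ∧ |a.2 - b.2| ≤ q.length := by
  induction q with
  | nil => simp
  | cons h q ih =>
    rw [SimpleGraph.Walk.length_cons]
    simp only [dualLattice] at h
    push_cast
    grind

/-- A `DualCycle` carries a base point that need not be `a`, but a short cycle through `a` has its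
base near `a`. -/
theorem finite_dualCycle_length_lt (a : DualVertex) (N : ℕ) :
    {γ : DualCycle | γ.PassesThrough a ∧ γ.walk.length < N}.Finite := by
  classical
  let F : Finset (Σ b, dualLattice.Walk b b) :=
    (Finset.Icc ((a.1 - N, a.2 - N) : ℤ × ℤ) (a.1 + N, a.2 + N)).sigma
      fun b => dualLattice.finsetWalkLengthLT N b b
  have hinj : Function.Injective
      fun γ : DualCycle => (⟨γ.base, γ.walk⟩ : Σ b, dualLattice.Walk b b) := by
    rintro ⟨b, q, hq⟩ ⟨c, r, hr⟩ h
    obtain ⟨rfl, h⟩ := Sigma.mk.inj h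
    cases eq_of_heq h
    rfl
  refine (F.finite_toSet.preimage hinj.injOn).subset ?_
  rintro γ ⟨ha, hN⟩
  refine Finset.mem_sigma.2 ⟨?_, SimpleGraph.mem_finsetWalkLengthLT_iff.2 hN⟩
  have h1 := abs_sub_le_length (γ.walk.takeUntil a ha)
  have h2 := γ.walk.length_takeUntil_le_length ha
  rw [abs_le, abs_le] at h1
  simp only [Finset.mem_Icc, Prod.le_def]
  omega

theorem finite_unsatisfied_dualCycle {p : Config} {a : DualVertex}
    (h : ∀ᶠ n in Filter.atTop, p ∉ circuitEvent a n) :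
    {γ : DualCycle | γ.PassesThrough a ∧ γ.IsUnsatisfied p}.Finite := by
  classical
  obtain ⟨N, hN⟩ := Filter.eventually_atTop.1 h
  refine (finite_dualCycle_length_lt a N).subset fun γ ⟨ha, hγ⟩ => ⟨ha, ?_⟩
  by_contra! hle
  -- Rerooting the cycle at `a` keeps its edges and length, so a long one would realise a forbidden
  -- `circuitEvent`.
  refine hN _ hle ⟨γ.walk.rotate a ha, (γ.isCircuit.rotate ha).isTrail,
    γ.walk.length_rotate a ha, fun e he => ?_⟩
  exact hγ e ((γ.walk.rotate_edges a ha).mem_iff.1 he)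

end EdwardsAnderson

theorem mainTheorem2 :
    ∃ β₀ : ℝ, 0 < β₀ ∧ ∀ β : ℝ, β₀ < β →
      ∀ ν : MeasureTheory.Measure EdwardsAnderson.Config,
        EdwardsAnderson.IsEADistribution β ν → EdwardsAnderson.IsTranslationInvariant ν →
          ∀ᵐ p ∂ν, ∀ a : EdwardsAnderson.DualVertex,
            {γ : EdwardsAnderson.DualCycle | γ.PassesThrough a ∧ γ.IsUnsatisfied p}.Finite := by
  obtain ⟨b, hb⟩ := Filter.eventually_atTop.1
    (EdwardsAnderson.tendsto_integral_exp_neg_abs.eventually_le_const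
      (by norm_num : (0 : ℝ) < 1 / 8))
  -- The maximum with `1` makes the threshold positive, whatever `b` is.
  refine ⟨max b 1, by positivity, fun β hβ ν hν _ => ?_⟩
  obtain ⟨hb', h1⟩ := max_lt_iff.1 hβ
  filter_upwards [EdwardsAnderson.ae_eventually_notMem_circuitEvent (by linarith) hν
    (hb β hb'.le)] with p hp a
  exact EdwardsAnderson.finite_unsatisfied_dualCycle (hp a)
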